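/- **Definitions.** Let $\Sigma$ be a terminal alphabet, $\#\notin\Sigma$ a delimiter and $\Sigma_\#=\Sigma\cup\{\#\}$. A precedence matrix $M$ assigns to each $(a,b)\in\Sigma_\#\times\Sigma_\#$ a set $M_{a,b}\subseteq\{\doteq,\lessdot,\gtrdot\}$; it is *conflict-free* if $|M_{a,b}|\le 1$ for all $a,b$, and then $(\Sigma,M)$ is an *OP-alphabet*. Matrices are compared cell by cell. Let $V_N$ be a nonterminal alphabet disjoint from $\Sigma$ and $V=\Sigma\cup V_N$. A *$^+$-O-expression* is an expression $\alpha$ built from elements of $V$ by concatenation and $^+$, such that no string of its language $L(\alpha)\subseteq V^+$ has two adjacent nonterminals and every argument of $^+$ ends (parentheses and $^+$ being ignored) with a terminal. A *cyclic O-grammar* $G$ consists of a finite set $P$ of rules $A\to\alpha$ with $A\in V_N$ and $\alpha$ a $^+$-O-expression that is not a single nonterminal, and a finite nonempty set $S\subseteq V_N$ of axioms; in addition there may be a single empty rule $A\to\varepsilon$, where $A\in S$ occurs in no right-hand side (for it, $L(\varepsilon)=\{\varepsilon\}$). One puts $\beta A\gamma\Rightarrow\beta\zeta\gamma$ if $A\to\alpha$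 is a rule and $\zeta\in L(\alpha)$, and $L(G)=\{w\in\Sigma^*\mid A\Rightarrow^* w \text{ for some } A\in S\}$. For $A\in V_N$ let $\mathcal L(A)=\{a\in\Sigma\mid A\Rightarrow^* Ca\alpha\}$ and $\mathcal R(A)=\{a\in\Sigma\mid A\Rightarrow^*\alpha aC\}$, with $C\in V_N\cup\{\varepsilon\}$, $\alpha\in V^*$. The matrix $OPM(G)$ contains exactly the following relations, where $a,b\in\Sigma$, $B\in V_N$, and $\zeta$ ranges over the strings in $L(\alpha)$ for the rules $A\to\alpha$ of $G$: $a\doteq b$ if some $\zeta$ has the form $\eta aCb\theta$ with $C\in V_N\cup\{\varepsilon\}$; $a\gtrdot b$ if some $\zeta=\eta Bb\theta$ with $a\in\mathcal R(B)$; $a\lessdot b$ if some $\zeta=\eta aB\theta$ with $b\in\mathcal L(B)$; $a\gtrdot\#$ if $a\in\mathcal R(B)$ for some $B\in S$; $\#\lessdot b$ if $b\in\mathcal L(B)$ for some $B\in S$. $G$ is a *cyclic operator precedence grammar* (C-OPG) if $OPM(G)$ is conflict-free. It is *backward deterministic* if $B\to\alpha,\ C\to\alpha\in P$ implies $B=C$.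 An *operator precedence automaton* (OPA) over $(\Sigma,M)$ has a finite state set $Q$, sets $I,F\subseteq Q$ of initial and final states, and functions $\delta_{\rm shift},\delta_{\rm push}:Q\times\Sigma\to\wp(Q)$, $\delta_{\rm pop}:Q\times Q\to\wp(Q)$. A configuration $\langle\Pi,q,w\rangle$ consists of a stack $\Pi\in\bot(\Sigma\times Q)^*$, a state $q$ and a remaining input $w\in\Sigma^*\#$; the symbol of $\bot$ is $\#$ and that of $[a,p]\in\Sigma\times Q$ is $a$. The moves are: push, $\langle\Pi,p,ax\rangle\vdash\langle\Pi[a,p],q,x\rangle$ if the top symbol $c$ of $\Pi$ satisfies $c\lessdot a$ and $q\in\delta_{\rm push}(p,a)$; shift, $\langle\Pi[a,p],q,bx\rangle\vdash\langle\Pi[b,p],r,x\rangle$ if $a\doteq b$ and $r\in\delta_{\rm shift}(q,b)$; pop, $\langle\Pi[a,p],q,bx\rangle\vdash\langle\Pi,r,bx\rangle$ if $a\gtrdot b$ and $r\in\delta_{\rm pop}(q,p)$. The OPA accepts $x\in\Sigma^*$ if $\langle\bot,q_I,x\#\rangle\vdash^*\langle\bot,q_F,\#\rangle$ for some $q_I\in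 I$, $q_F\in F$. It is *deterministic* if $|I|=1$ and all values of $\delta_{\rm shift},\delta_{\rm push},\delta_{\rm pop}$ have at most one element. **Theorem (From C-OPGs to OPAs).** There is an algorithm (a computable function on written descriptions) that transforms every C-OPG $G$ into the finite description $(Q,I,F,\delta)$ of an OPA such that, for every OP-alphabet $(\Sigma,M)$ with $OPM(G)\subseteq M$ (in particular for $M=OPM(G)$), the OPA $\mathcal A=\langle\Sigma,M,Q,I,F,\delta\rangle$ accepts exactly $L(G)$. Moreover, if $G$ is backward deterministic, then $\mathcal A$ is deterministic. -/

import Mathlib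

namespace OPL

/-! ### Operator precedence matrices -/

/-- The three precedence relations: `eq` is `≐`, `yields` is `⋖`, `takes` is `⋗`. -/
inductive Prec
  | eq
  | yields
  | takes

/-- A precedence matrix over the terminal alphabet `T` extended by the delimiter `#`,
which is `none : Option T`. -/
abbrev OPM (T : Type*) := Option T → Option T → Set Prec

/-- Every cell holds at most one relation; `(T, M)` is then an OP-alphabet. -/
def OPM.ConflictFree {T : Type*} (M : OPM T) : Prop :=
  ∀ a b, (M a b).Subsingleton

/-! ### Cyclic grammars -/

/-- Expressions built from the symbols of `V = T ∪ N` by concatenation and `⁺`. -/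
inductive PExpr (T N : Type*)
  | sym (v : T ⊕ N)
  | cat (e f : PExpr T N)
  | plus (e : PExpr T N)

namespace PExpr

variable {T N : Type*}

open scoped Computability in
/-- The language over `V` denoted by an expression. -/
def lang : PExpr T N → Language (T ⊕ N)
  | sym v => {[v]}
  | cat e f => e.lang * f.lang
  | plus e => e.lang * (e.lang)∗

/-- The last symbol of an expression, parentheses and `⁺` being ignored. -/
def last : PExpr T N → T ⊕ N
  | sym v => v
  | cat _ f => f.last
  | plus e => e.last

/-- Every argument of `⁺` is terminated by a terminal symbol. -/
def PlusTerminated : PExpr T N → Prop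
  | sym _ => True
  | cat e f => e.PlusTerminated ∧ f.PlusTerminated
  | plus e => e.PlusTerminated ∧ ∃ a : T, e.last = Sum.inl a

/-- `⁺`-O-expressions: no string denoted by the expression has two adjacent nonterminals, and
the arguments of `⁺` are terminated by a terminal. -/
def IsOExpr (e : PExpr T N) : Prop :=
  (∀ ζ ∈ e.lang, ¬ ∃ (η θ : List (T ⊕ N)) (A B : N), ζ = η ++ Sum.inr A :: Sum.inr B :: θ) ∧
    e.PlusTerminated

end PExpr

/-- The characters used to write down expressions: the symbols of `V`, the opening parenthesis
`(` (that is `Sum.inr false`) and the closing `)⁺` (that is `Sum.inr true`). -/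
abbrev Token (T N : Type*) := (T ⊕ N) ⊕ Bool

/-- The written form of an expression. -/
def PExpr.write {T N : Type*} : PExpr T N → List (Token T N)
  | .sym v => [Sum.inl v]
  | .cat e f => e.write ++ f.write
  | .plus e => Sum.inr false :: (e.write ++ [Sum.inr true])

/-- A right-hand side: an expression, or `none` for the empty string `ε`. -/
abbrev Rhs (T N : Type*) := Option (PExpr T N)

/-- The language over `V` denoted by a right-hand side. -/
def Rhs.lang {T N : Type*} : Rhs T N → Language (T ⊕ N)
  | none => 1
  | some e => e.lang

/-- The written form of a right-hand side; `ε` is the empty string. -/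
def Rhs.write {T N : Type*} : Rhs T N → List (Token T N)
  | none => []
  | some e => e.write

/-- A grammar with terminals in `T`, nonterminals in `N`, finitely many rules whose right-hand
sides are expressions (or `ε`), and a finite set `start` of start nonterminals. -/
structure Grammar (T N : Type*) where
  rules : List (N × Rhs T N)
  start : List N

namespace Grammar

variable {T N : Type*} (G : Grammar T N)

/-- Immediate derivation: `β A γ ⇒ β ζ γ` for a rule `A → α` and a string `ζ` in the language
of `α`. -/
def Derives1 (u v : List (T ⊕ N)) : Prop :=
  ∃ (β γ ζ : List (T ⊕ N)) (A : N) (α : Rhs T N),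
    (A, α) ∈ G.rules ∧ ζ ∈ α.lang ∧ u = β ++ Sum.inr A :: γ ∧ v = β ++ ζ ++ γ

/-- `⇒*` -/
def Derives : List (T ⊕ N) → List (T ⊕ N) → Prop :=
  Relation.ReflTransGen G.Derives1

/-- The language generated by the grammar. -/
def language : Language T :=
  {w | ∃ A ∈ G.start, G.Derives [Sum.inr A] (w.map Sum.inl)}

/-- A string of `V*` that is either a single nonterminal or empty. -/
def optNT (C : Option N) : List (T ⊕ N) := C.toList.map Sum.inr

/-- The left terminal set of `A`. -/
def leftSet (A : N) : Set T :=
  {a | ∃ (C : Option N) (α : List (T ⊕ N)), G.Derives [Sum.inr A] (optNT C ++ Sum.inl a :: α)}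

/-- The right terminal set of `A`. -/
def rightSet (A : N) : Set T :=
  {a | ∃ (C : Option N) (α : List (T ⊕ N)), G.Derives [Sum.inr A] (α ++ Sum.inl a :: optNT C)}

/-- `ζ` is a string denoted by the right-hand side of some rule. -/
def IsRhsString (ζ : List (T ⊕ N)) : Prop :=
  ∃ (A : N) (α : Rhs T N), (A, α) ∈ G.rules ∧ ζ ∈ α.lang

/-- The precedence matrix of the grammar. -/
def opm : OPM T
  | some a, some b => {r | match r with
      | .eq => ∃ (η θ : List (T ⊕ N)) (C : Option N),
          G.IsRhsString (η ++ Sum.inl a :: (optNT C ++ Sum.inl b :: θ))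
      | .takes => ∃ (η θ : List (T ⊕ N)) (B : N),
          G.IsRhsString (η ++ Sum.inr B :: Sum.inl b :: θ) ∧ a ∈ G.rightSet B
      | .yields => ∃ (η θ : List (T ⊕ N)) (B : N),
          G.IsRhsString (η ++ Sum.inl a :: Sum.inr B :: θ) ∧ b ∈ G.leftSet B}
  | some a, none => {r | r = .takes ∧ ∃ B ∈ G.start, a ∈ G.rightSet B}
  | none, some b => {r | r = .yields ∧ ∃ B ∈ G.start, b ∈ G.leftSet B}
  | none, none => ∅

/-- Cyclic O-grammars: there is a start nonterminal, the right-hand sides are `⁺`-O-expressions,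
there are no renaming rules, and no empty rules except possibly a single one, whose left-hand
side is a start nonterminal that occurs in no right-hand side. -/
structure IsCOG : Prop where
  start_ne : G.start ≠ []
  rhs : ∀ A e, (A, some e) ∈ G.rules → e.IsOExpr
  no_renaming : ∀ A e, (A, some e) ∈ G.rules → ∀ B : N, e ≠ .sym (Sum.inr B)
  empty_unique : ∀ A B, (A, none) ∈ G.rules → (B, none) ∈ G.rules → A = B
  empty_start : ∀ A, (A, none) ∈ G.rules → A ∈ G.start
  empty_not_rhs : ∀ A, (A, none) ∈ G.rules →
    ∀ B e, (B, some e) ∈ G.rules → Sum.inl (Sum.inr A) ∉ e.write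

/-- Cyclic operator precedence grammars. -/
structure IsCOPG : Prop where
  isCOG : G.IsCOG
  conflictFree : G.opm.ConflictFree

/-- Backward determinism: rules with the same right-hand side have the same left-hand side.
Right-hand sides are compared as written, so that the association of concatenations, which is
only a feature of the type `PExpr`, plays no role. -/
def BackwardDeterministic : Prop :=
  ∀ B C α β, (B, α) ∈ G.rules → (C, β) ∈ G.rules → Rhs.write α = Rhs.write β → B = C

end Grammar

/-! ### Operator precedence automata -/

/-- Operator precedence automata with input alphabet `T` and state set `Q`. -/
structure OPA (T Q : Type*) where
  M : OPM T
  init : Set Q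
  final : Set Q
  shift : Q → T → Set Q
  push : Q → T → Set Q
  pop : Q → Q → Set Q

/-- Configurations: the stack above `⊥` (its top is the head of the list), the current state, and
the remaining input without the closing delimiter `#`. -/
structure Config (T Q : Type*) where
  stack : List (T × Q)
  state : Q
  input : List T

namespace OPA

variable {T Q : Type*} (𝒜 : OPA T Q)

/-- The moves. The symbol on top of the stack is `#` if the stack is just `⊥`, and the next input
symbol is `#` if the rest of the input is empty. -/
inductive Step : Config T Q → Config T Q → Prop
  | push {s : List (T × Q)} {p q : Q} {a : T} {x : List T} :
      Prec.yields ∈ 𝒜.M (s.head?.map Prod.fst) (some a) → q ∈ 𝒜.push p a →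
      Step ⟨s, p, a :: x⟩ ⟨(a, p) :: s, q, x⟩
  | shift {s : List (T × Q)} {p q r : Q} {a b : T} {x : List T} :
      Prec.eq ∈ 𝒜.M (some a) (some b) → r ∈ 𝒜.shift q b →
      Step ⟨(a, p) :: s, q, b :: x⟩ ⟨(b, p) :: s, r, x⟩
  | pop {s : List (T × Q)} {p q r : Q} {a : T} {x : List T} :
      Prec.takes ∈ 𝒜.M (some a) x.head? → r ∈ 𝒜.pop q p →
      Step ⟨(a, p) :: s, q, x⟩ ⟨s, r, x⟩

/-- The accepted language. -/
def language : Language T :=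
  {x | ∃ qI ∈ 𝒜.init, ∃ qF ∈ 𝒜.final,
    Relation.ReflTransGen 𝒜.Step ⟨[], qI, x⟩ ⟨[], qF, []⟩}

/-- Determinism: one initial state, and at most one value of each transition function. -/
structure Deterministic : Prop where
  init : ∃ q, 𝒜.init = {q}
  shift : ∀ q a, (𝒜.shift q a).Subsingleton
  push : ∀ q a, (𝒜.push q a).Subsingleton
  pop : ∀ q p, (𝒜.pop q p).Subsingleton

end OPA

/-! ### Finite descriptions, on which algorithms operate -/

/-- Written grammars: the list of rules, and the list of start nonterminals. -/
abbrev GrammarCode (T N : Type*) := List (N × List (Token T N)) × List N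

/-- The written form of a grammar. -/
def Grammar.write {T N : Type*} (G : Grammar T N) : GrammarCode T N :=
  (G.rules.map fun r => (r.1, Rhs.write r.2), G.start)

/-- Written finite automata, without the precedence matrix: the number `n` of states (which are
`0, …, n - 1`), the lists of initial and of final states, and the tables of the shift, push and
pop transitions, where `(q, a, r)` stands for `r ∈ δ(q, a)` and `(q, p, r)` for
`r ∈ δ_pop(q, p)`. -/
abbrev OPACode (T : Type*) :=
  ℕ × List ℕ × List ℕ × List (ℕ × T × ℕ) × List (ℕ × T × ℕ) × List (ℕ × ℕ × ℕ)

/-- The automaton over `(T, M)` with a given written form. -/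
def OPACode.toOPA {T : Type*} (c : OPACode T) (M : OPM T) : OPA T (Fin c.1) where
  M := M
  init := {q | (q : ℕ) ∈ c.2.1}
  final := {q | (q : ℕ) ∈ c.2.2.1}
  shift q a := {r | ((q : ℕ), a, (r : ℕ)) ∈ c.2.2.2.1}
  push q a := {r | ((q : ℕ), a, (r : ℕ)) ∈ c.2.2.2.2.1}
  pop q p := {r | ((q : ℕ), (p : ℕ), (r : ℕ)) ∈ c.2.2.2.2.2}

end OPL

namespace OPL

/-! The automaton is a bottom-up parser made deterministic by a subset construction. Every
right-hand side, being a regular expression, becomes a finite graph labelled by `T ⊕ N`; in the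
disjoint union over all rules, paths from initial vertices to final vertices carrying `A` spell
exactly the strings denoted by the rules of `A` (`Grammar.exists_path_iff`). A state consists of the
set of vertices reachable by the right-hand side under construction, and the set of all nonterminals
to which the factor popped last reduces. A push saves the state and restarts from the initial
vertices, reading a pending nonterminal first; a shift advances; a pop collects the left-hand sides
of the final vertices reached and restores the saved vertex set. Nothing is guessed, so transitions
have at most one value.

Soundness: along the stack, the input read splits into yields of beginnings of right-hand sides, and
every move preserves this (`Recognizer.Invariant.step`). Completeness: a run follows the derivation
tree (`Recognizer.exists_run`). As `G.opm ≤ M`, the relation `⋖` is available at the first terminal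
of a right-hand side, `≐` between consecutive terminals and `⋗` after the last one; since
nonterminals are never adjacent, one pending set suffices.

For the algorithm, the graph is extracted from the written rules by one scan, the states are
enumerated as sublists and replaced by their indices without changing the language
(`Recognizer.language_code`), and all of this is primitive recursive (`Recognizer.primrec_code`). -/

/-! ### Paths in finite labelled graphs -/

/-- `Path E i ζ j`: a path from `i` to `j` with label `ζ`, along edges `((i, v), j) ∈ E`. -/
def Path {σ V : Type*} (E : List ((σ × V) × σ)) : σ → List V → σ → Prop
  | i, [], j => i = j
  | i, v :: ζ, j => ∃ k, ((i, v), k) ∈ E ∧ Path E k ζ j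

namespace Path

variable {σ V : Type*} {E E₁ E₂ : List ((σ × V) × σ)} {i j k : σ} {v : V} {ζ ζ₁ ζ₂ : List V}

theorem append_iff : Path E i (ζ₁ ++ ζ₂) j ↔ ∃ k, Path E i ζ₁ k ∧ Path E k ζ₂ j := by
  induction ζ₁ generalizing i with
  | nil => simp [Path]
  | cons v ζ₁ ih =>
    simp only [List.cons_append, Path, ih]
    constructor
    · rintro ⟨k, hk, l, h₁, h₂⟩
      exact ⟨l, ⟨k, hk, h₁⟩, h₂⟩
    · rintro ⟨l, ⟨k, hk, h₁⟩, h₂⟩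
      exact ⟨k, hk, l, h₁, h₂⟩

theorem append (h₁ : Path E i ζ₁ k) (h₂ : Path E k ζ₂ j) : Path E i (ζ₁ ++ ζ₂) j :=
  append_iff.2 ⟨k, h₁, h₂⟩

theorem singleton_iff : Path E i [v] j ↔ ((i, v), j) ∈ E := by
  simp [Path]

theorem mono (hE : ∀ e ∈ E₁, e ∈ E₂) (h : Path E₁ i ζ j) : Path E₂ i ζ j := by
  induction ζ generalizing i with
  | nil => exact h
  | cons v ζ ih =>
    obtain ⟨k, hk, h⟩ := h
    exact ⟨k, hE _ hk, ih h⟩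

/-- Every label on a path is the label of an edge. -/
theorem exists_edge (h : Path E i ζ j) (hv : v ∈ ζ) : ∃ e ∈ E, e.1.2 = v := by
  induction ζ generalizing i with
  | nil => simp at hv
  | cons u ζ ih =>
    obtain ⟨k, hk, h⟩ := h
    rcases List.mem_cons.1 hv with rfl | hv
    · exact ⟨_, hk, rfl⟩
    · exact ih h hv

section Descending

variable {F₁ F₂ : List ((ℕ × V) × ℕ)} {m a b : ℕ}

/-- Edges of `F₁` start at or above `m` and edges of `F₂` end below it, so a path that is below `m`
can neither use `F₁` nor climb back. -/
theorem of_lt (h₁ : ∀ e ∈ F₁, m ≤ e.1.1) (h₂ : ∀ e ∈ F₂, e.2 < m)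
    (h : Path (F₁ ++ F₂) a ζ b) (ha : a < m) : Path F₂ a ζ b := by
  induction ζ generalizing a with
  | nil => exact h
  | cons v ζ ih =>
    obtain ⟨k, hk, h⟩ := h
    rcases List.mem_append.1 hk with hk | hk
    · exact absurd (h₁ _ hk) (by simpa using ha)
    · exact ⟨k, hk, ih h (h₂ _ hk)⟩

/-- If `F₁` lives above `m` and `F₂` below, a path from above to below crosses `m` once. -/
theorem exists_split (h₁ : ∀ e ∈ F₁, m ≤ e.1.1 ∧ m ≤ e.2) (h₂ : ∀ e ∈ F₂, e.1.1 ≤ m ∧ e.2 < m)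
    (h : Path (F₁ ++ F₂) a ζ b) (ha : m ≤ a) (hb : b < m) :
    ∃ ζ₁ ζ₂, ζ = ζ₁ ++ ζ₂ ∧ Path F₁ a ζ₁ m ∧ Path F₂ m ζ₂ b := by
  induction ζ generalizing a with
  | nil =>
    have : a = b := h
    omega
  | cons v ζ ih =>
    obtain ⟨k, hk, h⟩ := h
    rcases List.mem_append.1 hk with hk | hk
    · obtain ⟨ζ₁, ζ₂, rfl, p₁, p₂⟩ := ih h (h₁ _ hk).2
      exact ⟨v :: ζ₁, ζ₂, rfl, ⟨k, hk, p₁⟩, p₂⟩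
    · obtain rfl : a = m := le_antisymm (h₂ _ hk).1 ha
      exact ⟨[], v :: ζ, rfl, rfl, k, hk,
        of_lt (fun e he => (h₁ e he).1) (fun e he => (h₂ e he).2) h (h₂ _ hk).2⟩

end Descending

end Path

/-! ### The graph of an expression -/

namespace PExpr

variable {T N : Type*}

/-- The number of symbols in an expression. -/
def size : PExpr T N → ℕ
  | sym _ => 1
  | cat e f => e.size + f.size
  | plus e => e.size

/-- The first symbol of an expression. -/
def first : PExpr T N → T ⊕ N
  | sym v => v
  | cat e _ => e.first
  | plus e => e.first

/-- The graph that recognizes an expression. Vertices are positions between symbols, numbered by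
the number of symbols to their right, where `o` symbols follow the expression. -/
def edges : PExpr T N → ℕ → List ((ℕ × (T ⊕ N)) × ℕ)
  | sym v, o => [((o + 1, v), o)]
  | cat e f, o => e.edges (o + f.size) ++ f.edges o
  | plus e, o => ((o, e.first), o + e.size - 1) :: e.edges o

theorem size_pos (e : PExpr T N) : 0 < e.size := by
  induction e with
  | sym v => simp [size]
  | cat e f ihe ihf => simp only [size]; omega
  | plus e ih => exact ih

/-- The last bound is strict: no edge enters the top vertex, because the loop edge of `⁺` aims at
the vertex after the first symbol. This allows the end of `e` and the beginning of `f` to be one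
vertex in a concatenation, crossed once. -/
theorem edges_bounds (e : PExpr T N) (o : ℕ) :
    ∀ x ∈ e.edges o, o ≤ x.1.1 ∧ x.1.1 ≤ o + e.size ∧ o ≤ x.2 ∧ x.2 < o + e.size := by
  induction e generalizing o with
  | sym v => simp [edges, size]
  | cat e f ihe ihf =>
    intro x hx
    simp only [edges, List.mem_append] at hx
    simp only [size]
    have := f.size_pos
    have := e.size_pos
    rcases hx with hx | hx
    · have := ihe _ x hx; omega
    · have := ihf _ x hx; omega
  | plus e ih =>
    intro x hx
    simp only [edges, List.mem_cons] at hx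
    simp only [size]
    have := e.size_pos
    rcases hx with rfl | hx
    · dsimp only; omega
    · exact ih _ x hx

theorem first_edge_mem (e : PExpr T N) (o : ℕ) :
    ((o + e.size, e.first), o + e.size - 1) ∈ e.edges o := by
  induction e generalizing o with
  | sym v => simp [edges, size, first]
  | cat e f ihe ihf =>
    have := ihe (o + f.size)
    simp only [edges, size, first, List.mem_append]
    left
    rwa [show o + (e.size + f.size) = o + f.size + e.size by omega]
  | plus e ih => exact List.mem_cons_of_mem _ (ih o)

/-- All edges leaving the top vertex agree, so a single loop edge from the bottom vertex can imitate
every restart of `e`. -/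
theorem eq_of_mem_edges_top (e : PExpr T N) (o : ℕ) :
    ∀ x ∈ e.edges o, x.1.1 = o + e.size → x.1.2 = e.first ∧ x.2 = o + e.size - 1 := by
  induction e generalizing o with
  | sym v => simp [edges, size, first]
  | cat e f ihe ihf =>
    intro x hx h
    simp only [edges, List.mem_append] at hx
    simp only [size, first] at h ⊢
    have := e.size_pos
    rcases hx with hx | hx
    · have := ihe _ x hx (by omega)
      exact ⟨this.1, by omega⟩
    · have := f.edges_bounds _ x hx
      omega
  | plus e ih =>
    intro x hx h
    simp only [edges, List.mem_cons] at hx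
    have := e.size_pos
    rcases hx with rfl | hx
    · simp only [size] at h
      omega
    · exact ih _ x hx h

-- The start `i` is arbitrary for the sake of the induction. A loop edge followed by the piece up to
-- the next visit to `o` under `e.edges` spells a word of `e.lang`, since the first edge of `e`
-- bears the same label and has the same target.
open scoped Computability in
theorem exists_split_plus (e : PExpr T N) (o : ℕ)
    (he : ∀ ζ, Path (e.edges o) (o + e.size) ζ o ↔ ζ ∈ e.lang) {i : ℕ} {ζ : List (T ⊕ N)}
    (h : Path (e.plus.edges o) i ζ o) :
    ∃ ζ₁ ζ₂, ζ = ζ₁ ++ ζ₂ ∧ Path (e.edges o) i ζ₁ o ∧ ζ₂ ∈ (e.lang)∗ := by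
  induction ζ generalizing i with
  | nil => exact ⟨[], [], rfl, h, Language.nil_mem_kstar _⟩
  | cons v ζ ih =>
    obtain ⟨k, hk, h⟩ := h
    obtain ⟨ζ₁, ζ₂, rfl, h₁, h₂⟩ := ih h
    simp only [edges, List.mem_cons] at hk
    rcases hk with hk | hk
    · obtain ⟨⟨rfl, rfl⟩, rfl⟩ : (i = o ∧ v = e.first) ∧ k = o + e.size - 1 := by
        simpa using hk
      refine ⟨[], e.first :: (ζ₁ ++ ζ₂), rfl, rfl, ?_⟩
      have hm : e.first :: ζ₁ ∈ e.lang := (he _).1 ⟨_, e.first_edge_mem i, h₁⟩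
      obtain ⟨L, rfl, hL⟩ := Language.mem_kstar.1 h₂
      exact Language.mem_kstar.2 ⟨(e.first :: ζ₁) :: L, by simp, by simpa using ⟨hm, hL⟩⟩
    · exact ⟨v :: ζ₁, ζ₂, rfl, ⟨k, hk, h₁⟩, h₂⟩

/-- The graph of an expression recognizes its language. -/
theorem path_edges_iff (e : PExpr T N) (o : ℕ) (ζ : List (T ⊕ N)) :
    Path (e.edges o) (o + e.size) ζ o ↔ ζ ∈ e.lang := by
  induction e generalizing o ζ with
  | sym v =>
    change _ ↔ ζ = [v]
    rcases ζ with _ | ⟨u, _ | ⟨w, ζ⟩⟩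
    · simp [Path, size]
    · simp [Path, edges, size]
    · simp [Path, edges, size]
  | cat e f ihe ihf =>
    simp only [lang, Language.mem_mul, size, ← ihf o, ← ihe (o + f.size)]
    rw [show o + (e.size + f.size) = o + f.size + e.size by omega]
    constructor
    · intro h
      have := f.size_pos
      obtain ⟨ζ₁, ζ₂, rfl, h₁, h₂⟩ := Path.exists_split (m := o + f.size)
        (fun x hx => ⟨(e.edges_bounds _ x hx).1, (e.edges_bounds _ x hx).2.2.1⟩)
        (fun x hx => ⟨(f.edges_bounds _ x hx).2.1, (f.edges_bounds _ x hx).2.2.2⟩)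
        h (by omega) (by omega)
      exact ⟨ζ₁, h₁, ζ₂, h₂, rfl⟩
    · rintro ⟨ζ₁, h₁, ζ₂, h₂, rfl⟩
      exact (h₁.mono fun x hx => List.mem_append_left _ hx).append
        (h₂.mono fun x hx => List.mem_append_right _ hx)
  | plus e ih =>
    simp only [lang, Language.mem_mul, size]
    constructor
    · intro h
      obtain ⟨ζ₁, ζ₂, rfl, h₁, h₂⟩ := e.exists_split_plus o (ih o) h
      exact ⟨ζ₁, (ih o _).1 h₁, ζ₂, h₂, rfl⟩
    · rintro ⟨ζ₁, h₁, ζ₂, h₂, rfl⟩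
      refine Path.append (k := o) (((ih o _).2 h₁).mono fun x hx => List.mem_cons_of_mem _ hx) ?_
      obtain ⟨L, rfl, hL⟩ := Language.mem_kstar.1 h₂
      clear h₂
      induction L with
      | nil => rfl
      | cons ξ L ihL =>
        have hξ := (ih o _).2 (hL ξ (by simp))
        refine Path.append (k := o) ?_ (ihL fun y hy => hL y (by simp [hy]))
        have := e.size_pos
        rcases ξ with _ | ⟨v, ξ⟩
        · have : o + e.size = o := hξ
          omega
        · obtain ⟨k, hk, hξ⟩ := hξ
          -- The first edge of this round leaves the top vertex; the loop edge from `o` has its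
          -- label and its target and replaces it.
          obtain ⟨rfl, rfl⟩ : v = e.first ∧ k = o + e.size - 1 :=
            e.eq_of_mem_edges_top o _ hk rfl
          exact ⟨_, List.mem_cons_self, hξ.mono fun x hx => List.mem_cons_of_mem _ hx⟩

end PExpr

/-! ### The graph of a written right-hand side -/

section Scan

variable {T N : Type*}

/-- The state of a scan from right to left: the number of symbols read, the symbol read last, the
positions of the open brackets, and the edges found. -/
abbrev ScanState (T N : Type*) :=
  ℕ × Option (T ⊕ N) × List ℕ × List ((ℕ × (T ⊕ N)) × ℕ)

/-- One step of the scan. -/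
def scanStep (t : Token T N) (s : ScanState T N) : ScanState T N :=
  match t with
  | .inl v => (s.1 + 1, some v, s.2.2.1, ((s.1 + 1, v), s.1) :: s.2.2.2)
  | .inr true => (s.1, s.2.1, s.1 :: s.2.2.1, s.2.2.2)
  | .inr false => (s.1, s.2.1, s.2.2.1.tail,
      (s.2.2.1.head?.bind fun r => s.2.1.map fun v => ((r, v), s.1 - 1)).toList ++ s.2.2.2)

/-- The scan of a written right-hand side. -/
def scan (l : List (Token T N)) : ScanState T N := l.foldr scanStep (0, none, [], [])

/-- The written form determines the graph without parsing: from the right, a closing bracket records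
the position `o`, and at the matching opening bracket the symbol read last is the first symbol of
the argument and the counter is `o` plus its size, which is all the loop edge needs. -/
theorem foldr_scanStep_write (e : PExpr T N) (s : ScanState T N) :
    e.write.foldr scanStep s =
      (s.1 + e.size, some e.first, s.2.2.1, e.edges s.1 ++ s.2.2.2) := by
  induction e generalizing s with
  | sym v => rfl
  | cat e f ihe ihf =>
    simp [PExpr.write, ihe, ihf, PExpr.size, PExpr.first, PExpr.edges]
    omega
  | plus e ih =>
    simp [PExpr.write, ih, PExpr.size, PExpr.first, PExpr.edges, scanStep]

/-- The items of a grammar: written rules together with a position. -/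
abbrev Item (T N : Type*) := (N × List (Token T N)) × ℕ

/-- The graph of a grammar: the disjoint union of the graphs of its rules. -/
def ruleEdges (R : List (N × List (Token T N))) : List ((Item T N × (T ⊕ N)) × Item T N) :=
  R.flatMap fun r => (scan r.2).2.2.2.map fun e => (((r, e.1.1), e.1.2), (r, e.2))

/-- The items at the beginning of a rule. -/
def ruleInit (R : List (N × List (Token T N))) : List (Item T N) :=
  R.map fun r => (r, (scan r.2).1)

/-- The items at the end of a rule, with its left-hand side. -/
def ruleFinal (R : List (N × List (Token T N))) : List (Item T N × N) :=
  R.map fun r => ((r, 0), r.1)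

/-- An item contains its whole written rule, so a path can never leave the rule in which it starts.
-/
theorem path_ruleEdges_iff {R : List (N × List (Token T N))} {r : N × List (Token T N)}
    (hr : r ∈ R) {i : ℕ} {ζ : List (T ⊕ N)} {j : Item T N} :
    Path (ruleEdges R) (r, i) ζ j ↔ j.1 = r ∧ Path (scan r.2).2.2.2 i ζ j.2 := by
  induction ζ generalizing i with
  | nil =>
    obtain ⟨r', j⟩ := j
    simp [Path, eq_comm]
  | cons v ζ ih =>
    constructor
    · rintro ⟨k, hk, h⟩
      simp only [ruleEdges, List.mem_flatMap, List.mem_map, Prod.exists] at hk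
      obtain ⟨a, b, hr', i', v', k', hk', heq⟩ := hk
      simp only [Prod.mk.injEq] at heq
      obtain ⟨⟨⟨rfl, rfl⟩, rfl⟩, rfl⟩ := heq
      obtain ⟨h₁, h₂⟩ := ih.1 h
      exact ⟨h₁, k', hk', h₂⟩
    · rintro ⟨h₁, k, hk, h₂⟩
      exact ⟨(r, k), List.mem_flatMap.2 ⟨r, hr, List.mem_map.2 ⟨_, hk, rfl⟩⟩, ih.2 ⟨h₁, h₂⟩⟩

theorem path_scan_write_iff (α : Rhs T N) (ζ : List (T ⊕ N)) :
    Path (scan (Rhs.write α)).2.2.2 (scan (Rhs.write α)).1 ζ 0 ↔ ζ ∈ α.lang := by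
  cases α with
  | none =>
    change Path [] 0 ζ 0 ↔ ζ = []
    cases ζ <;> simp [Path]
  | some e =>
    simp only [Rhs.write, Rhs.lang, scan, foldr_scanStep_write, List.append_nil]
    exact e.path_edges_iff 0 ζ

/-- The graph of a grammar recognizes the strings denoted by its right-hand sides. -/
theorem Grammar.exists_path_iff (G : Grammar T N) (A : N) (ζ : List (T ⊕ N)) :
    (∃ i ∈ ruleInit G.write.1, ∃ j, Path (ruleEdges G.write.1) i ζ j ∧
      (j, A) ∈ ruleFinal G.write.1) ↔ ∃ α, (A, α) ∈ G.rules ∧ ζ ∈ α.lang := by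
  constructor
  · rintro ⟨i, hi, j, h, hj⟩
    obtain ⟨r, hr, rfl⟩ := List.mem_map.1 hi
    obtain ⟨r', -, hr'⟩ := List.mem_map.1 hj
    obtain ⟨rfl, rfl⟩ : (r', 0) = j ∧ r'.1 = A := by simpa using hr'
    obtain ⟨rfl, h⟩ := (path_ruleEdges_iff hr).1 h
    obtain ⟨⟨A, α⟩, hα, rfl⟩ := List.mem_map.1 hr
    exact ⟨α, hα, (path_scan_write_iff α ζ).1 h⟩
  · rintro ⟨α, hα, hζ⟩
    have hr : (A, Rhs.write α) ∈ G.write.1 := List.mem_map.2 ⟨_, hα, rfl⟩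
    exact ⟨_, List.mem_map.2 ⟨_, hr, rfl⟩, ((A, Rhs.write α), 0),
      (path_ruleEdges_iff hr).2 ⟨rfl, (path_scan_write_iff α ζ).2 hζ⟩,
      List.mem_map.2 ⟨_, hr, rfl⟩⟩

end Scan

/-! ### Derivations of terminal strings -/

namespace Grammar

variable {T N : Type*} {G : Grammar T N}

/-- `G.HasRule A ζ`: the string `ζ` is denoted by the right-hand side of a rule for `A`. -/
def HasRule (G : Grammar T N) (A : N) (ζ : List (T ⊕ N)) : Prop :=
  ∃ α, (A, α) ∈ G.rules ∧ ζ ∈ Rhs.lang α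

/-- Derivations of terminal strings, organized as forests. -/
inductive Yield (G : Grammar T N) : List (T ⊕ N) → List T → Prop
  | nil : Yield G [] []
  | term {a : T} {ζ w} : Yield G ζ w → Yield G (Sum.inl a :: ζ) (a :: w)
  | nonterm {A : N} {ξ ζ u w} :
      G.HasRule A ξ → Yield G ξ u → Yield G ζ w → Yield G (Sum.inr A :: ζ) (u ++ w)

theorem Yield.append {ζ₁ ζ₂ : List (T ⊕ N)} {w₁ w₂ : List T} (h₁ : G.Yield ζ₁ w₁)
    (h₂ : G.Yield ζ₂ w₂) : G.Yield (ζ₁ ++ ζ₂) (w₁ ++ w₂) := by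
  induction h₁ with
  | nil => exact h₂
  | term _ ih => exact ih.term
  | nonterm hr h _ _ ih =>
    rw [List.append_assoc]
    exact .nonterm hr h ih

theorem Yield.split {ζ₁ ζ₂ : List (T ⊕ N)} {w : List T} (h : G.Yield (ζ₁ ++ ζ₂) w) :
    ∃ w₁ w₂, w = w₁ ++ w₂ ∧ G.Yield ζ₁ w₁ ∧ G.Yield ζ₂ w₂ := by
  induction ζ₁ generalizing w with
  | nil => exact ⟨[], w, rfl, .nil, h⟩
  | cons v ζ₁ ih =>
    cases h with
    | term h =>
      obtain ⟨w₁, w₂, rfl, h₁, h₂⟩ := ih h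
      exact ⟨_, w₂, rfl, h₁.term, h₂⟩
    | nonterm hr h h' =>
      obtain ⟨w₁, w₂, rfl, h₁, h₂⟩ := ih h'
      exact ⟨_, w₂, (List.append_assoc ..).symm, .nonterm hr h h₁, h₂⟩

theorem Yield.of_hasRule {A : N} {ζ : List (T ⊕ N)} {w : List T} (hr : G.HasRule A ζ)
    (h : G.Yield ζ w) : G.Yield [Sum.inr A] w := by
  simpa using Yield.nonterm hr h .nil

theorem yield_map_inl (w : List T) : G.Yield (w.map Sum.inl) w := by
  induction w with
  | nil => exact .nil
  | cons a w ih => exact ih.term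

theorem HasRule.derives1 {A : N} {ζ : List (T ⊕ N)} (h : G.HasRule A ζ) (β γ : List (T ⊕ N)) :
    G.Derives1 (β ++ Sum.inr A :: γ) (β ++ ζ ++ γ) := by
  obtain ⟨α, hα, hζ⟩ := h
  exact ⟨β, γ, ζ, A, α, hα, hζ, rfl, rfl⟩

theorem Derives.context {u v : List (T ⊕ N)} (h : G.Derives u v) (β γ : List (T ⊕ N)) :
    G.Derives (β ++ u ++ γ) (β ++ v ++ γ) := by
  refine Relation.ReflTransGen.lift (fun x => β ++ x ++ γ) ?_ _ _ h
  rintro _ _ ⟨β', γ', ζ, A, α, hα, hζ, rfl, rfl⟩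
  exact ⟨β ++ β', γ' ++ γ, ζ, A, α, hα, hζ, by simp, by simp⟩

theorem Derives.trans {u v w : List (T ⊕ N)} (h₁ : G.Derives u v) (h₂ : G.Derives v w) :
    G.Derives u w :=
  Relation.ReflTransGen.trans h₁ h₂

theorem HasRule.derives {A : N} {ζ : List (T ⊕ N)} (h : G.HasRule A ζ) :
    G.Derives [Sum.inr A] ζ :=
  .single (by simpa using h.derives1 [] [])

theorem Yield.derives {ζ : List (T ⊕ N)} {w : List T} (h : G.Yield ζ w) :
    G.Derives ζ (w.map Sum.inl) := by
  induction h with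
  | nil => exact .refl
  | @term a ζ w _ ih => simpa using ih.context [Sum.inl a] []
  | @nonterm A ξ ζ u w hr _ _ ih₁ ih₂ =>
    have h₁ := (hr.derives.trans ih₁).context [] ζ
    have h₂ := ih₂.context (u.map Sum.inl) []
    simp only [List.nil_append, List.append_nil, List.singleton_append] at h₁ h₂
    rw [List.map_append]
    exact h₁.trans h₂

/-- Induction from the first derivation step: the forest over `β ++ ζ ++ γ` is cut into three, and
the middle part is hung under a new node `A`. -/
theorem Derives.yield {ζ : List (T ⊕ N)} {w : List T} (h : G.Derives ζ (w.map Sum.inl)) :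
    G.Yield ζ w := by
  induction h using Relation.ReflTransGen.head_induction_on with
  | refl => exact yield_map_inl w
  | head h _ ih =>
    obtain ⟨β, γ, ζ, A, α, hα, hζ, rfl, rfl⟩ := h
    obtain ⟨_, w₃, rfl, h, h₃⟩ := ih.split
    obtain ⟨w₁, w₂, rfl, h₁, h₂⟩ := h.split
    rw [List.append_assoc]
    exact h₁.append (.nonterm ⟨α, hα, hζ⟩ h₂ h₃)

theorem mem_language_iff {w : List T} :
    w ∈ G.language ↔ ∃ A ∈ G.start, G.Yield [Sum.inr A] w :=
  exists_congr fun _ => and_congr_right fun _ => ⟨Derives.yield, Yield.derives⟩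

/-! ### Left and right terminal sets -/

theorem HasRule.mem_leftSet {A : N} {C : Option N} {a : T} {θ : List (T ⊕ N)}
    (h : G.HasRule A (optNT C ++ Sum.inl a :: θ)) : a ∈ G.leftSet A :=
  ⟨C, θ, h.derives⟩

theorem HasRule.mem_rightSet {A : N} {C : Option N} {a : T} {η : List (T ⊕ N)}
    (h : G.HasRule A (η ++ Sum.inl a :: optNT C)) : a ∈ G.rightSet A :=
  ⟨C, η, h.derives⟩

theorem HasRule.leftSet_subset {A B : N} {θ : List (T ⊕ N)}
    (h : G.HasRule A (Sum.inr B :: θ)) : G.leftSet B ⊆ G.leftSet A := by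
  rintro a ⟨C, α, hd⟩
  refine ⟨C, α ++ θ, h.derives.trans ?_⟩
  simpa using hd.context [] θ

theorem HasRule.rightSet_subset {A B : N} {η : List (T ⊕ N)}
    (h : G.HasRule A (η ++ [Sum.inr B])) : G.rightSet B ⊆ G.rightSet A := by
  rintro a ⟨C, α, hd⟩
  refine ⟨C, η ++ α, h.derives.trans ?_⟩
  simpa using hd.context η []

theorem HasRule.isRhsString {A : N} {ζ : List (T ⊕ N)} (h : G.HasRule A ζ) : G.IsRhsString ζ :=
  ⟨A, h⟩

end Grammar

/-! ### Strings denoted by right-hand sides -/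

namespace PExpr

variable {T N : Type*}

theorem getLast?_of_mem_lang {e : PExpr T N} {ζ : List (T ⊕ N)} (h : ζ ∈ e.lang) :
    ζ.getLast? = some e.last := by
  induction e generalizing ζ with
  | sym v =>
    obtain rfl : ζ = [v] := h
    rfl
  | cat e f ihe ihf =>
    obtain ⟨ζ₁, -, ζ₂, h₂, rfl⟩ := Language.mem_mul.1 h
    simp [ihf h₂, last]
  | plus e ih =>
    obtain ⟨ζ₁, h₁, ζ₂, h₂, rfl⟩ := Language.mem_mul.1 h
    obtain ⟨L, rfl, hL⟩ := Language.mem_kstar.1 h₂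
    clear h h₂
    induction L generalizing ζ₁ with
    | nil => simpa [last] using ih h₁
    | cons ξ L ihL =>
      have := ihL ξ (hL ξ (by simp)) fun y hy => hL y (by simp [hy])
      rw [List.flatten_cons, List.getLast?_append, this]
      rfl

theorem ne_nil_of_mem_lang {e : PExpr T N} {ζ : List (T ⊕ N)} (h : ζ ∈ e.lang) : ζ ≠ [] := by
  rintro rfl
  simpa using getLast?_of_mem_lang h

/-- The ban on renaming rules concerns expressions, not strings. An expression `B⁺` would also
denote the string `B`, but arguments of `⁺` end with a terminal; a concatenation only denotes
strings of length at least two. -/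
theorem eq_sym_of_singleton_mem_lang {e : PExpr T N} {B : N} (he : e.PlusTerminated)
    (h : [Sum.inr B] ∈ e.lang) : e = sym (Sum.inr B) := by
  cases e with
  | sym v =>
    obtain rfl : Sum.inr B = v := List.singleton_injective h
    rfl
  | cat e f =>
    obtain ⟨ζ₁, h₁, ζ₂, h₂, h⟩ := Language.mem_mul.1 h
    have := congrArg List.length h
    have := List.length_pos_of_ne_nil (ne_nil_of_mem_lang h₁)
    have := List.length_pos_of_ne_nil (ne_nil_of_mem_lang h₂)
    simp at *
    omega
  | plus e =>
    obtain ⟨-, a, ha⟩ := he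
    have := getLast?_of_mem_lang h
    simp [last, ha] at this

theorem mem_write_of_mem_lang {e : PExpr T N} {ζ : List (T ⊕ N)} (h : ζ ∈ e.lang) :
    ∀ v ∈ ζ, Sum.inl v ∈ e.write := by
  induction e generalizing ζ with
  | sym v =>
    obtain rfl : ζ = [v] := h
    simp [write]
  | cat e f ihe ihf =>
    obtain ⟨ζ₁, h₁, ζ₂, h₂, rfl⟩ := Language.mem_mul.1 h
    intro v hv
    rcases List.mem_append.1 hv with hv | hv
    · exact List.mem_append_left _ (ihe h₁ v hv)
    · exact List.mem_append_right _ (ihf h₂ v hv)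
  | plus e ih =>
    obtain ⟨ζ₁, h₁, ζ₂, h₂, rfl⟩ := Language.mem_mul.1 h
    obtain ⟨L, rfl, hL⟩ := Language.mem_kstar.1 h₂
    intro v hv
    suffices Sum.inl v ∈ e.write by simp [write, this]
    rcases List.mem_append.1 hv with hv | hv
    · exact ih h₁ v hv
    · obtain ⟨ξ, hξ, hv⟩ := List.mem_flatten.1 hv
      exact ih (hL ξ hξ) v hv

end PExpr

namespace Grammar

variable {T N : Type*} {G : Grammar T N}

theorem IsCOG.not_adjacent (hG : G.IsCOG) {A B C : N} {η θ : List (T ⊕ N)} :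
    ¬ G.HasRule A (η ++ Sum.inr B :: Sum.inr C :: θ) := by
  rintro ⟨_ | e, hα, hζ⟩
  · have : η ++ Sum.inr B :: Sum.inr C :: θ = [] := hζ
    simp at this
  · exact (hG.rhs A e hα).1 _ hζ ⟨η, θ, B, C, rfl⟩

theorem IsCOG.not_singleton (hG : G.IsCOG) {A B : N} : ¬ G.HasRule A [Sum.inr B] := by
  rintro ⟨_ | e, hα, hζ⟩
  · exact List.cons_ne_nil _ _ hζ
  · exact hG.no_renaming A e hα B (PExpr.eq_sym_of_singleton_mem_lang (hG.rhs A e hα).2 hζ)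

/-- Hence the factor of a nonterminal inside a right-hand side is never rewritten directly to `ε`,
for which the automaton would have no move. -/
theorem IsCOG.not_nil (hG : G.IsCOG) {A B : N} {η θ : List (T ⊕ N)}
    (h : G.HasRule A (η ++ Sum.inr B :: θ)) : ¬ G.HasRule B [] := by
  rintro ⟨_ | e, hα, hζ⟩
  · obtain ⟨_ | f, hf, hm⟩ := h
    · have : η ++ Sum.inr B :: θ = [] := hm
      simp at this
    · exact hG.empty_not_rhs B hα A f hf (PExpr.mem_write_of_mem_lang hm _ (by simp))
  · exact PExpr.ne_nil_of_mem_lang hζ rfl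

end Grammar

/-! ### The deterministic automaton -/

/-- The entries of the table `L` under the keys `K`. -/
def select {κ β : Type*} [DecidableEq κ] (L : List (κ × β)) (K : List κ) : List β :=
  (L.filter fun e => e.1 ∈ K).map Prod.snd

theorem mem_select {κ β : Type*} [DecidableEq κ] {L : List (κ × β)} {K : List κ} {b : β} :
    b ∈ select L K ↔ ∃ k ∈ K, (k, b) ∈ L := by
  simp [select, and_comm]

/-- This bounds the state space: filtering keeps order and multiplicity, so all sets that the
automaton computes are sublists of fixed lists. -/
theorem select_sublist {κ β : Type*} [DecidableEq κ] (L : List (κ × β)) (K : List κ) :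
    (select L K).Sublist (L.map Prod.snd) :=
  List.filter_sublist.map _

/-- A finite graph labelled by `T ⊕ N` with its initial vertices, its final vertices, which carry
a nonterminal, and a list of start nonterminals. -/
abbrev Recognizer (T N σ : Type*) :=
  List ((σ × (T ⊕ N)) × σ) × List σ × List (σ × N) × List N

/-- The states of the automaton: the vertices that can be reached by the part of a right-hand side
read so far, and the nonterminals to which the factor just popped can be reduced, if any. -/
abbrev DState (N σ : Type*) := List σ × Option (List N)

namespace Recognizer

variable {T N σ : Type*}

open Grammar (optNT)

/-- The terminals that label an edge. -/
def terminals (X : Recognizer T N σ) : List T := X.1.filterMap fun e => e.1.2.getLeft?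

theorem mem_terminals {X : Recognizer T N σ} {a : T} :
    a ∈ X.terminals ↔ ∃ e ∈ X.1, e.1.2 = Sum.inl a := by
  simp [terminals]

/-- `Option.Rel (· ∈ ·) C p` says that `C` is one of the pending candidates, or that there is no
candidate set and no nonterminal. -/
theorem yield_optNT {C : Option N} {p : Option (List N)} {v : List T} {G : Grammar T N}
    (hC : Option.Rel (· ∈ ·) C p) (h₀ : p = none → v = [])
    (h₁ : ∀ Cs, p = some Cs → ∀ C ∈ Cs, G.Yield [Sum.inr C] v) : G.Yield (optNT C) v := by
  cases hC with
  | none =>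
    rw [h₀ rfl]
    exact .nil
  | some h => exact h₁ _ rfl _ h

variable [DecidableEq T] [DecidableEq N] [DecidableEq σ]

/-- The vertices reached from `D` by reading the pending nonterminal, if any. -/
def read (X : Recognizer T N σ) (D : List σ) (p : Option (List N)) : List σ :=
  p.elim D fun Cs => select X.1 (D ×ˢ Cs.map Sum.inr)

/-- The vertices reached from `D` by reading the pending nonterminal, if any, and `a`. -/
def advance (X : Recognizer T N σ) (D : List σ) (p : Option (List N)) (a : T) : List σ :=
  select X.1 (X.read D p ×ˢ [Sum.inl a])

/-- The shift transition. -/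
def shift (X : Recognizer T N σ) (q : DState N σ) (a : T) : DState N σ :=
  (X.advance q.1 q.2 a, none)

/-- The push transition. -/
def push (X : Recognizer T N σ) (q : DState N σ) (a : T) : DState N σ :=
  (X.advance X.2.1 q.2 a, none)

/-- The pop transition. -/
def pop (X : Recognizer T N σ) (q p : DState N σ) : DState N σ :=
  (p.1, some (select X.2.2.1 (X.read q.1 q.2)))

/-- Final states: the factor just popped, or the empty string, can be reduced to a start
nonterminal. -/
def Final (X : Recognizer T N σ) (q : DState N σ) : Prop :=
  ∃ A ∈ q.2.getD (select X.2.2.1 X.2.1), A ∈ X.2.2.2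

/-- The automaton over `(T, M)`. -/
def toOPA (X : Recognizer T N σ) (M : OPM T) : OPA T (DState N σ) where
  M := M
  init := {([], none)}
  final := {q | X.Final q}
  shift q a := {r | a ∈ X.terminals ∧ r = X.shift q a}
  push q a := {r | a ∈ X.terminals ∧ r = X.push q a}
  pop q p := {X.pop q p}

theorem mem_read {X : Recognizer T N σ} {D : List σ} {p : Option (List N)} {k : σ} :
    k ∈ X.read D p ↔
      ∃ i ∈ D, ∃ C, Option.Rel (· ∈ ·) C p ∧ Path X.1 i (optNT C) k := by
  cases p with
  | none =>
    constructor
    · exact fun h => ⟨k, h, none, .none, rfl⟩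
    · rintro ⟨i, hi, _, ⟨⟩, rfl⟩
      exact hi
  | some Cs =>
    simp only [read, Option.elim, mem_select, List.mem_product, List.mem_map, Prod.exists]
    constructor
    · rintro ⟨i, _, ⟨hi, C, hC, rfl⟩, h⟩
      exact ⟨i, hi, some C, .some hC, k, h, rfl⟩
    · rintro ⟨i, hi, _, @⟨C, _, hC⟩, k, h, rfl⟩
      exact ⟨i, Sum.inr C, ⟨hi, C, hC, rfl⟩, h⟩

theorem mem_advance {X : Recognizer T N σ} {D : List σ} {p : Option (List N)} {a : T} {k : σ} :
    k ∈ X.advance D p a ↔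
      ∃ i ∈ D, ∃ C, Option.Rel (· ∈ ·) C p ∧ Path X.1 i (optNT C ++ [Sum.inl a]) k := by
  simp only [advance, mem_select, List.mem_product, mem_read, Path.append_iff,
    Path.singleton_iff, Prod.exists, List.mem_singleton]
  constructor
  · rintro ⟨j, _, ⟨⟨i, hi, C, hC, h⟩, rfl⟩, h'⟩
    exact ⟨i, hi, C, hC, j, h, h'⟩
  · rintro ⟨i, hi, C, hC, j, h, h'⟩
    exact ⟨j, _, ⟨⟨i, hi, C, hC, h⟩, rfl⟩, h'⟩

/-- The strings leading from an initial vertex to a final vertex with nonterminal `A` are those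
denoted by the right-hand sides of `A`, and the start nonterminals are those of `G`. -/
def Recognizes (X : Recognizer T N σ) (G : Grammar T N) : Prop :=
  X.2.2.2 = G.start ∧
    ∀ A ζ, (∃ i ∈ X.2.1, ∃ j, Path X.1 i ζ j ∧ (j, A) ∈ X.2.2.1) ↔ G.HasRule A ζ

variable {X : Recognizer T N σ} {G : Grammar T N} {M : OPM T}

/-! ### Soundness -/

/-- The invariant of the automaton: the input read so far, up to the factor popped last, splits
along the stack into the yields of beginnings of right-hand sides. -/
def Core (X : Recognizer T N σ) (G : Grammar T N) :
    List (T × DState N σ) → List σ → List T → Prop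
  | [], _, u => u = []
  | (_, p) :: s, D, u => ∃ u₀ w, u = u₀ ++ w ∧ Core X G s p.1 u₀ ∧
      ∀ k ∈ D, ∃ i ∈ X.2.1, ∃ ζ, Path X.1 i ζ k ∧ G.Yield ζ w

/-- The invariant for configurations after reading `u`. -/
def Invariant (X : Recognizer T N σ) (G : Grammar T N) (s : List (T × DState N σ))
    (q : DState N σ) (u : List T) : Prop :=
  ∃ u₁ v, u = u₁ ++ v ∧ Core X G s q.1 u₁ ∧
    (q.2 = none → v = []) ∧ ∀ Cs, q.2 = some Cs → ∀ C ∈ Cs, G.Yield [Sum.inr C] v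

/-- The invariant survives every move whatever precedence relation permits it. On the empty stack it
says nothing about the vertex set, which only shifts and pops would read. -/
theorem Invariant.step (hX : X.Recognizes G) {c c' : Config T (DState N σ)} {u w : List T}
    (h : (X.toOPA M).Step c c') (hc : Invariant X G c.stack c.state u) (hw : u ++ c.input = w) :
    ∃ u', Invariant X G c'.stack c'.state u' ∧ u' ++ c'.input = w := by
  obtain ⟨u₁, v, rfl, hcore, h₀, h₁⟩ := hc
  cases h with
  | @push s p q a x _ hq =>
    obtain ⟨-, rfl⟩ : a ∈ X.terminals ∧ q = X.push p a := hq
    refine ⟨u₁ ++ v ++ [a], ⟨u₁ ++ v ++ [a], [], by simp, ?_, by simp, by simp [push]⟩,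
      by simpa using hw⟩
    -- The factor `v` popped last becomes the beginning of the new right-hand side, so it joins the
    -- new stack segment.
    refine ⟨u₁, v ++ [a], by simp, hcore, fun k hk => ?_⟩
    obtain ⟨i, hi, C, hC, hp⟩ := mem_advance.1 hk
    exact ⟨i, hi, _, hp, (yield_optNT hC h₀ h₁).append (.term .nil)⟩
  | @shift s p q r a b x _ hr =>
    obtain ⟨-, rfl⟩ : b ∈ X.terminals ∧ r = X.shift q b := hr
    obtain ⟨u₀, w', rfl, hcore, hD⟩ := hcore
    refine ⟨u₀ ++ w' ++ v ++ [b], ⟨u₀ ++ w' ++ v ++ [b], [], by simp, ?_, by simp,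
      by simp [shift]⟩, by simpa using hw⟩
    refine ⟨u₀, w' ++ (v ++ [b]), by simp, hcore, fun k hk => ?_⟩
    obtain ⟨j, hj, C, hC, hp⟩ := mem_advance.1 hk
    obtain ⟨i, hi, ζ, hζ, hy⟩ := hD j hj
    exact ⟨i, hi, _, hζ.append hp, hy.append ((yield_optNT hC h₀ h₁).append (.term .nil))⟩
  | @pop s p q r a x _ hr =>
    obtain rfl : r = X.pop q p := hr
    obtain ⟨u₀, w', rfl, hcore, hD⟩ := hcore
    -- The removed segment together with `v` is the new popped factor.
    refine ⟨u₀ ++ w' ++ v, ⟨u₀, w' ++ v, by simp, hcore, by simp [pop], ?_⟩, hw⟩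
    rintro Cs hCs A hA
    obtain rfl : select X.2.2.1 (X.read q.1 q.2) = Cs := by simpa [pop] using hCs
    obtain ⟨k, hk, hF⟩ := mem_select.1 hA
    obtain ⟨j, hj, C, hC, hp⟩ := mem_read.1 hk
    obtain ⟨i, hi, ζ, hζ, hy⟩ := hD j hj
    exact (hy.append (yield_optNT hC h₀ h₁)).of_hasRule
      ((hX.2 _ _).1 ⟨i, hi, k, hζ.append hp, hF⟩)

theorem language_toOPA_le (hX : X.Recognizes G) : (X.toOPA M).language ≤ G.language := by
  rintro w ⟨_, rfl, q, hq, h⟩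
  obtain ⟨u, ⟨u₁, v, rfl, rfl, h₀, h₁⟩, hu⟩ :
      ∃ u, Invariant X G [] q u ∧ u ++ [] = w := by
    have key : ∀ c, Relation.ReflTransGen (X.toOPA M).Step ⟨[], ([], none), w⟩ c →
        ∃ u, Invariant X G c.stack c.state u ∧ u ++ c.input = w := by
      intro c hc
      induction hc with
      | refl => exact ⟨[], ⟨[], [], rfl, rfl, by simp, by simp⟩, rfl⟩
      | tail _ h ih =>
        obtain ⟨u, hu, hw⟩ := ih
        exact hu.step hX h hw
    exact key _ h
  simp only [List.nil_append, List.append_nil] at hu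
  subst hu
  obtain ⟨A, hA, hs⟩ : ∃ A ∈ q.2.getD (select X.2.2.1 X.2.1), A ∈ X.2.2.2 := hq
  rw [hX.1] at hs
  refine Grammar.mem_language_iff.2 ⟨A, hs, ?_⟩
  rcases hp : q.2 with _ | Cs
  -- Without a pending set the word is empty, and the default in `Final` looks for a vertex both
  -- initial and final, that is, for a path of length zero.
  · rw [hp, Option.getD_none] at hA
    obtain ⟨k, hk, hF⟩ := mem_select.1 hA
    rw [h₀ hp]
    exact Grammar.Yield.nil.of_hasRule ((hX.2 A []).1 ⟨k, hk, k, rfl, hF⟩)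
  · rw [hp] at hA
    exact h₁ Cs hp A hA

/-! ### Completeness -/

/-- The run of the automaton on the yield `w` of the end `ζ` of a right-hand side of `A`, if no
terminal has been read before `ζ` (first part), and if one has (second part). -/
theorem exists_run (hX : X.Recognizes G) (hG : G.IsCOG) (hM : G.opm ≤ M)
    {ζ : List (T ⊕ N)} {w : List T} (h : G.Yield ζ w) :
    (∀ (A : N) (C : Option N) (D : List σ) (p : Option (List N)) (s : List (T × DState N σ))
      (x : List T), G.HasRule A (optNT C ++ ζ) → ζ ≠ [] → Option.Rel (· ∈ ·) C p →
      (∀ b ∈ G.leftSet A, Prec.yields ∈ M (s.head?.map Prod.fst) (some b)) →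
      (∀ b ∈ G.rightSet A, Prec.takes ∈ M (some b) x.head?) →
      ∃ Cs, A ∈ Cs ∧
        Relation.ReflTransGen (X.toOPA M).Step ⟨s, (D, p), w ++ x⟩ ⟨s, (D, some Cs), x⟩) ∧
    ∀ (A : N) (η : List (T ⊕ N)) (a : T) (C : Option N) (D : List σ) (p : Option (List N))
      (q : DState N σ) (s : List (T × DState N σ)) (x : List T) (i j : σ),
      G.HasRule A (η ++ Sum.inl a :: (optNT C ++ ζ)) → i ∈ D → Path X.1 i (optNT C ++ ζ) j →
      (j, A) ∈ X.2.2.1 → Option.Rel (· ∈ ·) C p →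
      (∀ b ∈ G.rightSet A, Prec.takes ∈ M (some b) x.head?) →
      ∃ Cs, A ∈ Cs ∧ Relation.ReflTransGen (X.toOPA M).Step
        ⟨(a, q) :: s, (D, p), w ++ x⟩ ⟨s, (q.1, some Cs), x⟩ := by
  induction h with
  | nil =>
    refine ⟨fun A C D p s x _ h => absurd rfl h, ?_⟩
    intro A η a C D p q s x i j hr hi hp hF hC hR
    rw [List.append_nil] at hr hp
    -- The right-hand side is exhausted and its last terminal `a` is on top of the stack, so `a`
    -- takes precedence over the lookahead.
    exact ⟨_, mem_select.2 ⟨j, mem_read.2 ⟨i, hi, C, hC, hp⟩, hF⟩,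
      .single (.pop (hR a hr.mem_rightSet) rfl)⟩
  | @term b ζ w _ ih =>
    constructor
    · intro A C D p s x hr _ hC hL hR
      obtain ⟨i, hi, j, hp, hF⟩ := (hX.2 _ _).2 hr
      -- `T` may be infinite, so transitions exist only for terminals that label an edge.
      have hb := mem_terminals.2 (hp.exists_edge (v := Sum.inl b) (by simp))
      rw [show optNT C ++ Sum.inl b :: ζ = (optNT C ++ [Sum.inl b]) ++ ζ by simp] at hp
      obtain ⟨k, hk, hp⟩ := Path.append_iff.1 hp
      obtain ⟨Cs, hA, hrun⟩ := ih.2 A (optNT C) b none _ none (D, p) s x k j hr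
        (mem_advance.2 ⟨i, hi, C, hC, hk⟩) hp hF .none hR
      exact ⟨Cs, hA, .head (.push (hL b hr.mem_leftSet) ⟨hb, rfl⟩) hrun⟩
    · intro A η a C D p q s x i j hr hi hp hF hC hR
      have hb := mem_terminals.2 (hp.exists_edge (v := Sum.inl b) (by simp))
      rw [show optNT C ++ Sum.inl b :: ζ = (optNT C ++ [Sum.inl b]) ++ ζ by simp] at hp
      obtain ⟨k, hk, hp⟩ := Path.append_iff.1 hp
      have heq : Prec.eq ∈ M (some a) (some b) := hM _ _ ⟨η, ζ, C, hr.isRhsString⟩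
      rw [← List.cons_append, ← List.append_assoc] at hr
      obtain ⟨Cs, hA, hrun⟩ := ih.2 A _ b none _ none q s x k j hr
        (mem_advance.2 ⟨i, hi, C, hC, hk⟩) hp hF .none hR
      exact ⟨Cs, hA, .head (.shift heq ⟨hb, rfl⟩) hrun⟩
  | @nonterm B ξ ζ u w hB _ _ ihB ih =>
    -- After `B` comes either the end of the right-hand side, where the lookahead is unchanged and
    -- `rightSet B ⊆ rightSet A`, or a terminal, where `G.opm` provides `⋗`.
    have hnext : ∀ {A : N} {η : List (T ⊕ N)} {x : List T},
        G.HasRule A (η ++ Sum.inr B :: ζ) → G.Yield ζ w →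
        (∀ b ∈ G.rightSet A, Prec.takes ∈ M (some b) x.head?) →
        ∀ b ∈ G.rightSet B, Prec.takes ∈ M (some b) (w ++ x).head? := by
      intro A η x hr hy hR b hb
      cases hy with
      | nil => exact hR b (hr.rightSet_subset hb)
      | @term c ζ w _ => exact hM _ _ ⟨η, ζ, B, hr.isRhsString, hb⟩
      | nonterm => exact absurd hr hG.not_adjacent
    have hξ : ∀ {A : N} {η : List (T ⊕ N)}, G.HasRule A (η ++ Sum.inr B :: ζ) → ξ ≠ [] := by
      rintro A η hr rfl
      exact hG.not_nil hr hB
    constructor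
    · intro A C D p s x hr _ hC hL hR
      cases hC with
      | some =>
        exact absurd hr (hG.not_adjacent (η := []))
      | none =>
        -- A leading `B` is processed on the same stack, before the push for `A`; its left terminals
        -- are left terminals of `A`.
        obtain ⟨Cs, hBC, hrun⟩ := ihB.1 B none D none s (w ++ x) hB (hξ hr) .none
          (fun b hb => hL b (hr.leftSet_subset hb)) (hnext hr ‹_› hR)
        have hζ : ζ ≠ [] := by
          rintro rfl
          exact hG.not_singleton hr
        obtain ⟨Cs', hA, hrun'⟩ := ih.1 A (some B) D (some Cs) s x hr hζ (.some hBC) hL hR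
        rw [List.append_assoc]
        exact ⟨Cs', hA, hrun.trans hrun'⟩
    · intro A η a C D p q s x i j hr hi hp hF hC hR
      cases hC with
      | @some C _ _ =>
        rw [show η ++ Sum.inl a :: (optNT (some C) ++ Sum.inr B :: ζ) =
          (η ++ [Sum.inl a]) ++ Sum.inr C :: Sum.inr B :: ζ by simp [optNT]] at hr
        exact absurd hr hG.not_adjacent
      | none =>
        have hr' : G.HasRule A ((η ++ [Sum.inl a]) ++ Sum.inr B :: ζ) := by
          simpa [optNT] using hr
        -- Now `B` follows the terminal `a` on top of the stack, and `a ⋖ b` for every left terminal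
        -- `b` of `B`.
        obtain ⟨Cs, hBC, hrun⟩ := ihB.1 B none D none ((a, q) :: s) (w ++ x) hB (hξ hr') .none
          (fun b hb => hM _ _ ⟨η, ζ, B, hr.isRhsString, hb⟩) (hnext hr' ‹_› hR)
        obtain ⟨Cs', hA, hrun'⟩ := ih.2 A η a (some B) D (some Cs) q s x i j hr hi hp hF
          (.some hBC) hR
        rw [List.append_assoc]
        exact ⟨Cs', hA, hrun.trans hrun'⟩

theorem le_language_toOPA (hX : X.Recognizes G) (hG : G.IsCOG) (hM : G.opm ≤ M) :
    G.language ≤ (X.toOPA M).language := by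
  intro w hw
  obtain ⟨A, hA, hy⟩ := Grammar.mem_language_iff.1 hw
  cases hy with
  | @nonterm _ ζ _ u w hr hy hnil =>
  cases hnil
  rw [List.append_nil]
  refine ⟨_, rfl, ?_⟩
  by_cases hζ : ζ = []
  · subst hζ
    cases hy
    obtain ⟨i, hi, _, rfl, hF⟩ := (hX.2 _ _).2 hr
    exact ⟨([], none), ⟨A, mem_select.2 ⟨i, hi, hF⟩, hX.1 ▸ hA⟩, .refl⟩
  -- Empty stack and empty input both stand for `#`; the start nonterminal `A` supplies the
  -- relations with it.
  · obtain ⟨Cs, hCs, hrun⟩ := (exists_run hX hG hM hy).1 A none [] none [] [] hr hζ .none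
      (fun b hb => hM _ _ ⟨rfl, A, hA, hb⟩) (fun b hb => hM _ _ ⟨rfl, A, hA, hb⟩)
    rw [List.append_nil] at hrun
    exact ⟨([], some Cs), ⟨A, hCs, hX.1 ▸ hA⟩, hrun⟩

theorem language_toOPA (hX : X.Recognizes G) (hG : G.IsCOG) (hM : G.opm ≤ M) :
    (X.toOPA M).language = G.language :=
  le_antisymm (language_toOPA_le hX) (le_language_toOPA hX hG hM)

end Recognizer

/-! ### Simulations -/

namespace OPA

variable {T Q Q' : Type*}

/-- A simulation of an automaton by another one over the same OP-alphabet. -/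
structure IsSimulation (𝒜 : OPA T Q) (ℬ : OPA T Q') (R : Q → Q' → Prop) : Prop where
  M : 𝒜.M = ℬ.M
  init : ∀ q ∈ 𝒜.init, ∃ q' ∈ ℬ.init, R q q'
  final : ∀ q q', R q q' → q ∈ 𝒜.final → q' ∈ ℬ.final
  shift : ∀ q q' a, R q q' → ∀ r ∈ 𝒜.shift q a, ∃ r' ∈ ℬ.shift q' a, R r r'
  push : ∀ q q' a, R q q' → ∀ r ∈ 𝒜.push q a, ∃ r' ∈ ℬ.push q' a, R r r'
  pop : ∀ q q' p p', R q q' → R p p' → ∀ r ∈ 𝒜.pop q p, ∃ r' ∈ ℬ.pop q' p', R r r'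

variable {𝒜 : OPA T Q} {ℬ : OPA T Q'} {R : Q → Q' → Prop}

/-- Related stacks carry the same symbols, so the same precedence relations are tested, and related
saved states, which is what a pop requires. -/
theorem IsSimulation.exists_step (h : IsSimulation 𝒜 ℬ R) {c d : Config T Q} {s' : List (T × Q')}
    {q' : Q'} (hc : 𝒜.Step c d) (hs : List.Forall₂ (fun x y => x.1 = y.1 ∧ R x.2 y.2) c.stack s')
    (hq : R c.state q') :
    ∃ t' r', ℬ.Step ⟨s', q', c.input⟩ ⟨t', r', d.input⟩ ∧
      List.Forall₂ (fun x y => x.1 = y.1 ∧ R x.2 y.2) d.stack t' ∧ R d.state r' := by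
  cases hc with
  | push hM hr =>
    obtain ⟨r', hr', hR⟩ := h.push _ _ _ hq _ hr
    refine ⟨_, r', .push ?_ hr', .cons ⟨rfl, hq⟩ hs, hR⟩
    rw [h.M] at hM
    cases hs with
    | nil => exact hM
    | cons hx _ => simpa [hx.1] using hM
  | shift hM hr =>
    obtain ⟨r', hr', hR⟩ := h.shift _ _ _ hq _ hr
    rw [h.M] at hM
    cases hs with
    | @cons _ y _ _ hx hs =>
      obtain ⟨b, p'⟩ := y
      obtain ⟨rfl, hp⟩ := hx
      exact ⟨_, r', .shift hM hr', .cons ⟨rfl, hp⟩ hs, hR⟩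
  | pop hM hr =>
    rw [h.M] at hM
    cases hs with
    | @cons _ y _ _ hx hs =>
      obtain ⟨b, p'⟩ := y
      obtain ⟨rfl, hp⟩ := hx
      obtain ⟨r', hr', hR⟩ := h.pop _ _ _ _ hq hp _ hr
      exact ⟨_, r', .pop hM hr', hs, hR⟩

theorem IsSimulation.language_le (h : IsSimulation 𝒜 ℬ R) : 𝒜.language ≤ ℬ.language := by
  rintro w ⟨q, hq, f, hf, hrun⟩
  obtain ⟨q', hq', hR⟩ := h.init q hq
  have key : ∀ c, Relation.ReflTransGen 𝒜.Step ⟨[], q, w⟩ c → ∃ t' r',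
      Relation.ReflTransGen ℬ.Step ⟨[], q', w⟩ ⟨t', r', c.input⟩ ∧
      List.Forall₂ (fun x y => x.1 = y.1 ∧ R x.2 y.2) c.stack t' ∧ R c.state r' := by
    intro c hc
    induction hc with
    | refl => exact ⟨[], q', .refl, .nil, hR⟩
    | tail _ hstep ih =>
      obtain ⟨t', r', hrun, hs, hr⟩ := ih
      obtain ⟨t'', r'', hstep', hs', hr'⟩ := h.exists_step hstep hs hr
      exact ⟨t'', r'', hrun.tail hstep', hs', hr'⟩
  obtain ⟨t', f', hrun', hs, hf'⟩ := key _ hrun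
  cases hs
  exact ⟨q', hq', f', h.final _ _ hf' hf, hrun'⟩

end OPA

/-! ### The written form of the deterministic automaton -/

namespace Recognizer

variable {T N σ : Type*}

/-- A finite list that contains all states which occur in runs of the automaton. -/
def states (X : Recognizer T N σ) : List (DState N σ) :=
  (X.1.map Prod.snd).sublists' ×ˢ (none :: (X.2.2.1.map Prod.snd).sublists'.map some)

theorem init_mem_states (X : Recognizer T N σ) : ([], none) ∈ X.states := by
  simp [states]

variable [DecidableEq T] [DecidableEq N] [DecidableEq σ]

theorem shift_mem_states (X : Recognizer T N σ) (q : DState N σ) (a : T) :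
    X.shift q a ∈ X.states := by
  simp [states, shift, advance, select_sublist]

theorem push_mem_states (X : Recognizer T N σ) (q : DState N σ) (a : T) :
    X.push q a ∈ X.states := by
  simp [states, push, advance, select_sublist]

theorem pop_mem_states (X : Recognizer T N σ) (q : DState N σ) {p : DState N σ}
    (hp : p ∈ X.states) : X.pop q p ∈ X.states := by
  have := (List.mem_product.1 hp).1
  simp_all [states, pop, select_sublist]

instance (X : Recognizer T N σ) : DecidablePred X.Final := fun q =>
  inferInstanceAs (Decidable (∃ A ∈ q.2.getD (select X.2.2.1 X.2.1), A ∈ X.2.2.2))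

/-- The written form of the automaton; states are numbered by their place in `X.states`. -/
def code (X : Recognizer T N σ) : OPACode T :=
  (X.states.length, [X.states.idxOf ([], none)],
    (X.states.filter fun q => X.Final q).map fun q => X.states.idxOf q,
    X.states.flatMap fun q => X.terminals.map fun a =>
      (X.states.idxOf q, a, X.states.idxOf (X.shift q a)),
    X.states.flatMap fun q => X.terminals.map fun a =>
      (X.states.idxOf q, a, X.states.idxOf (X.push q a)),
    X.states.flatMap fun q => X.states.map fun p =>
      (X.states.idxOf q, X.states.idxOf p, X.states.idxOf (X.pop q p)))

/-- `k` is the number of the state `q`. -/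
def IsNumber (X : Recognizer T N σ) (q : DState N σ) (k : Fin X.code.1) : Prop :=
  q ∈ X.states ∧ X.states.idxOf q = k

theorem exists_isNumber {X : Recognizer T N σ} {q : DState N σ} (hq : q ∈ X.states) :
    ∃ k, X.IsNumber q k :=
  ⟨⟨X.states.idxOf q, List.idxOf_lt_length_of_mem hq⟩, hq, rfl⟩

/-- `X.states` may list a state several times; only its first place is its number, and the other
places carry no transitions. -/
theorem IsNumber.unique {X : Recognizer T N σ} {q r : DState N σ} {k : Fin X.code.1}
    (hq : X.IsNumber q k) (hr : r ∈ X.states) (h : X.states.idxOf r = k) : r = q :=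
  (List.idxOf_inj hr).1 (h.trans hq.2.symm)

section

variable {X : Recognizer T N σ} {M : OPM T} {q p : DState N σ} {k l m : Fin X.code.1} {a : T}

theorem mem_init_code : k ∈ (OPACode.toOPA X.code M).init ↔ X.IsNumber ([], none) k := by
  change (k : ℕ) ∈ [X.states.idxOf ([], none)] ↔ _
  simp [IsNumber, init_mem_states, eq_comm]

theorem mem_final_code :
    k ∈ (OPACode.toOPA X.code M).final ↔ ∃ q, X.Final q ∧ X.IsNumber q k := by
  simp only [OPACode.toOPA, code, IsNumber, List.mem_map, List.mem_filter,
    decide_eq_true_eq]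
  constructor
  · rintro ⟨q, ⟨h₁, h₂⟩, h₃⟩
    exact ⟨q, h₂, h₁, h₃⟩
  · rintro ⟨q, h₂, h₁, h₃⟩
    exact ⟨q, ⟨h₁, h₂⟩, h₃⟩

theorem mem_shift_code : m ∈ (OPACode.toOPA X.code M).shift k a ↔
    a ∈ X.terminals ∧ ∃ q, X.IsNumber q k ∧ X.IsNumber (X.shift q a) m := by
  simp only [OPACode.toOPA, code, IsNumber, List.mem_flatMap, List.mem_map,
    shift_mem_states, Prod.mk.injEq]
  constructor
  · rintro ⟨q, hq, a, ha, hk, rfl, hm⟩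
    exact ⟨ha, q, ⟨hq, hk⟩, trivial, hm⟩
  · rintro ⟨ha, q, ⟨hq, hk⟩, -, hm⟩
    exact ⟨q, hq, a, ha, hk, rfl, hm⟩

theorem mem_push_code : m ∈ (OPACode.toOPA X.code M).push k a ↔
    a ∈ X.terminals ∧ ∃ q, X.IsNumber q k ∧ X.IsNumber (X.push q a) m := by
  simp only [OPACode.toOPA, code, IsNumber, List.mem_flatMap, List.mem_map,
    push_mem_states, Prod.mk.injEq]
  constructor
  · rintro ⟨q, hq, a, ha, hk, rfl, hm⟩
    exact ⟨ha, q, ⟨hq, hk⟩, trivial, hm⟩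
  · rintro ⟨ha, q, ⟨hq, hk⟩, -, hm⟩
    exact ⟨q, hq, a, ha, hk, rfl, hm⟩

theorem mem_pop_code : m ∈ (OPACode.toOPA X.code M).pop k l ↔
    ∃ q p, X.IsNumber q k ∧ X.IsNumber p l ∧ X.IsNumber (X.pop q p) m := by
  simp only [OPACode.toOPA, code, IsNumber, List.mem_flatMap, List.mem_map,
    Prod.mk.injEq]
  constructor
  · rintro ⟨q, hq, p, hp, hk, hl, hm⟩
    exact ⟨q, p, ⟨hq, hk⟩, ⟨hp, hl⟩, X.pop_mem_states q hp, hm⟩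
  · rintro ⟨q, p, ⟨hq, hk⟩, ⟨hp, hl⟩, -, hm⟩
    exact ⟨q, hq, p, hp, hk, hl, hm⟩

theorem IsNumber.left_unique (hq : X.IsNumber q k) (hp : X.IsNumber p k) : q = p :=
  hp.unique hq.1 hq.2

theorem IsNumber.right_unique (hk : X.IsNumber q k) (hl : X.IsNumber q l) : k = l :=
  Fin.ext (hk.2.symm.trans hl.2)

end

theorem deterministic_code (X : Recognizer T N σ) (M : OPM T) :
    (OPACode.toOPA X.code M).Deterministic where
  init := by
    obtain ⟨k, hk⟩ := exists_isNumber X.init_mem_states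
    exact ⟨k, Set.ext fun l => mem_init_code.trans
      ⟨fun hl => hl.right_unique hk, fun hl => hl ▸ hk⟩⟩
  shift k a l hl m hm := by
    obtain ⟨-, q, hq, hl⟩ := mem_shift_code.1 hl
    obtain ⟨-, r, hr, hm⟩ := mem_shift_code.1 hm
    obtain rfl := hq.left_unique hr
    exact hl.right_unique hm
  push k a l hl m hm := by
    obtain ⟨-, q, hq, hl⟩ := mem_push_code.1 hl
    obtain ⟨-, r, hr, hm⟩ := mem_push_code.1 hm
    obtain rfl := hq.left_unique hr
    exact hl.right_unique hm
  pop k k' l hl m hm := by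
    obtain ⟨q, p, hq, hp, hl⟩ := mem_pop_code.1 hl
    obtain ⟨q', p', hq', hp', hm⟩ := mem_pop_code.1 hm
    obtain rfl := hq.left_unique hq'
    obtain rfl := hp.left_unique hp'
    exact hl.right_unique hm

/-- Membership in `X.states` is part of `IsNumber`, so the closure of `X.states` under the moves is
what keeps the relation alive. -/
theorem isSimulation_code (X : Recognizer T N σ) (M : OPM T) :
    OPA.IsSimulation (X.toOPA M) (OPACode.toOPA X.code M) X.IsNumber where
  M := rfl
  init := by
    rintro _ rfl
    obtain ⟨k, hk⟩ := exists_isNumber X.init_mem_states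
    exact ⟨k, mem_init_code.2 hk, hk⟩
  final q k hk hq := mem_final_code.2 ⟨q, hq, hk⟩
  shift := by
    rintro q k a hk _ ⟨ha, rfl⟩
    obtain ⟨m, hm⟩ := exists_isNumber (X.shift_mem_states q a)
    exact ⟨m, mem_shift_code.2 ⟨ha, q, hk, hm⟩, hm⟩
  push := by
    rintro q k a hk _ ⟨ha, rfl⟩
    obtain ⟨m, hm⟩ := exists_isNumber (X.push_mem_states q a)
    exact ⟨m, mem_push_code.2 ⟨ha, q, hk, hm⟩, hm⟩
  pop := by
    rintro q k p l hk hl _ rfl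
    obtain ⟨m, hm⟩ := exists_isNumber (X.pop_mem_states q hl.1)
    exact ⟨m, mem_pop_code.2 ⟨q, p, hk, hl, hm⟩, hm⟩

theorem isSimulation_code_flip (X : Recognizer T N σ) (M : OPM T) :
    OPA.IsSimulation (OPACode.toOPA X.code M) (X.toOPA M) (flip X.IsNumber) where
  M := rfl
  init k hk := ⟨_, rfl, mem_init_code.1 hk⟩
  final k q hk h := by
    obtain ⟨r, hr, hk'⟩ := mem_final_code.1 h
    obtain rfl := hk'.left_unique hk
    exact hr
  shift k q a hk m hm := by
    obtain ⟨ha, r, hr, hm⟩ := mem_shift_code.1 hm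
    obtain rfl := hr.left_unique hk
    exact ⟨_, ⟨ha, rfl⟩, hm⟩
  push k q a hk m hm := by
    obtain ⟨ha, r, hr, hm⟩ := mem_push_code.1 hm
    obtain rfl := hr.left_unique hk
    exact ⟨_, ⟨ha, rfl⟩, hm⟩
  pop k q l p hk hl m hm := by
    obtain ⟨q', p', hq', hp', hm⟩ := mem_pop_code.1 hm
    obtain rfl := hq'.left_unique hk
    obtain rfl := hp'.left_unique hl
    exact ⟨_, rfl, hm⟩

theorem language_code (X : Recognizer T N σ) (M : OPM T) :
    (OPACode.toOPA X.code M).language = (X.toOPA M).language :=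
  le_antisymm (X.isSimulation_code_flip M).language_le (X.isSimulation_code M).language_le

end Recognizer

/-- The recognizer of a written grammar. -/
def GrammarCode.recognizer {T N : Type*} (g : GrammarCode T N) : Recognizer T N (Item T N) :=
  (ruleEdges g.1, ruleInit g.1, ruleFinal g.1, g.2)

theorem Grammar.recognizes {T N : Type*} (G : Grammar T N) :
    (GrammarCode.recognizer G.write).Recognizes G :=
  ⟨rfl, G.exists_path_iff⟩

/-! ### Computability -/

section Primrec

variable {α β γ κ : Type*} [Primcodable α] [Primcodable β] [Primcodable γ] [Primcodable κ]

theorem primrecRel_mem [DecidableEq α] : PrimrecRel fun (a : α) (l : List α) => a ∈ l :=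
  ((PrimrecRel.exists_mem_list (R := fun a b : α => a = b) Primrec.eq).comp Primrec.snd
    Primrec.fst).of_eq fun p => by simp

theorem primrec_select [DecidableEq κ] :
    Primrec₂ (select : List (κ × β) → List κ → List β) := by
  have h : PrimrecRel fun (e : κ × β) (K : List κ) => e.1 ∈ K :=
    primrecRel_mem.comp (Primrec.fst.comp Primrec.fst) Primrec.snd
  exact Primrec.list_map h.listFilter (Primrec.snd.comp Primrec.snd).to₂

theorem primrec_product : Primrec₂ fun (l : List α) (m : List β) => l ×ˢ m :=
  Primrec.list_flatMap Primrec.fst (Primrec.list_map (Primrec.snd.comp Primrec.fst)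
    (Primrec.pair (Primrec.snd.comp Primrec.fst) Primrec.snd).to₂).to₂

theorem primrec_sublists' : Primrec (List.sublists' : List α → List (List α)) := by
  have h : Primrec fun l : List α => l.foldr (fun a L => L ++ L.map (List.cons a)) [[]] :=
    Primrec.list_foldr Primrec.id (Primrec.const _)
      (Primrec.list_append.comp (Primrec.snd.comp Primrec.snd)
        (Primrec.list_map (Primrec.snd.comp Primrec.snd)
          (Primrec.list_cons.comp (Primrec.fst.comp (Primrec.snd.comp Primrec.fst))
            Primrec.snd).to₂)).to₂
  refine h.of_eq fun l => ?_
  induction l with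
  | nil => rfl
  | cons a l ih => simp [ih]

end Primrec

section Scan

variable {T N : Type*} [Primcodable T] [Primcodable N]

theorem primrec_scanStep : Primrec₂ (scanStep : Token T N → ScanState T N → ScanState T N) := by
  have n : Primrec fun s : ScanState T N => s.1 := Primrec.fst
  have h : Primrec fun s : ScanState T N => s.2.1 := Primrec.fst.comp Primrec.snd
  have k : Primrec fun s : ScanState T N => s.2.2.1 :=
    Primrec.fst.comp (Primrec.snd.comp Primrec.snd)
  have e : Primrec fun s : ScanState T N => s.2.2.2 :=
    Primrec.snd.comp (Primrec.snd.comp Primrec.snd)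
  have hsym : Primrec₂ fun (s : ScanState T N) (v : T ⊕ N) =>
      ((s.1 + 1, some v, s.2.2.1, ((s.1 + 1, v), s.1) :: s.2.2.2) : ScanState T N) := by
    have n₁ : Primrec fun p : ScanState T N × (T ⊕ N) => p.1.1 + 1 :=
      Primrec.succ.comp (n.comp Primrec.fst)
    exact Primrec.pair n₁ (.pair (Primrec.option_some.comp Primrec.snd) (.pair (k.comp Primrec.fst)
      (Primrec.list_cons.comp (.pair (.pair n₁ Primrec.snd) (n.comp Primrec.fst))
        (e.comp Primrec.fst))))
  have hclose : Primrec fun s : ScanState T N =>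
      ((s.1, s.2.1, s.1 :: s.2.2.1, s.2.2.2) : ScanState T N) :=
    .pair n (.pair h (.pair (Primrec.list_cons.comp n k) e))
  have hedge : Primrec fun s : ScanState T N =>
      s.2.2.1.head?.bind fun r => s.2.1.map fun v => ((r, v), s.1 - 1) :=
    Primrec.option_bind (Primrec.list_head?.comp k)
      (Primrec.option_map (h.comp Primrec.fst)
        (Primrec.pair (Primrec.pair (Primrec.snd.comp Primrec.fst) Primrec.snd)
          (Primrec.pred.comp (n.comp (Primrec.fst.comp Primrec.fst)))).to₂).to₂
  have hopen : Primrec fun s : ScanState T N => ((s.1, s.2.1, s.2.2.1.tail,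
      (s.2.2.1.head?.bind fun r => s.2.1.map fun v => ((r, v), s.1 - 1)).toList ++ s.2.2.2) :
        ScanState T N) :=
    .pair n (.pair h (.pair (Primrec.list_tail.comp k)
      (Primrec.list_append.comp (Primrec.optionToList.comp hedge) e)))
  refine (Primrec.sumCasesOn (f := fun p : Token T N × ScanState T N => p.1) Primrec.fst
    (hsym.comp (Primrec.snd.comp Primrec.fst) Primrec.snd).to₂
    (Primrec.cond Primrec.snd (hclose.comp (Primrec.snd.comp Primrec.fst))
      (hopen.comp (Primrec.snd.comp Primrec.fst))).to₂).of_eq ?_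
  rintro ⟨_ | _ | _, s⟩ <;> rfl

theorem primrec_scan : Primrec (scan : List (Token T N) → ScanState T N) :=
  Primrec.list_foldr Primrec.id (Primrec.const _) (primrec_scanStep.comp₂
    (Primrec.fst.comp Primrec.snd).to₂ (Primrec.snd.comp Primrec.snd).to₂)

theorem primrec_ruleEdges : Primrec (ruleEdges (T := T) (N := N)) := by
  have he : Primrec fun r : N × List (Token T N) => (scan r.2).2.2.2 :=
    Primrec.snd.comp (Primrec.snd.comp (Primrec.snd.comp (primrec_scan.comp Primrec.snd)))
  exact Primrec.list_flatMap Primrec.id (Primrec.list_map (he.comp Primrec.snd)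
    (Primrec.pair
      (.pair (.pair (Primrec.snd.comp Primrec.fst) (Primrec.fst.comp (Primrec.fst.comp Primrec.snd)))
        (Primrec.snd.comp (Primrec.fst.comp Primrec.snd)))
      (.pair (Primrec.snd.comp Primrec.fst) (Primrec.snd.comp Primrec.snd))).to₂).to₂

theorem primrec_recognizer :
    Primrec (GrammarCode.recognizer : GrammarCode T N → Recognizer T N (Item T N)) := by
  have hi : Primrec (ruleInit (T := T) (N := N)) :=
    Primrec.list_map Primrec.id (Primrec.pair Primrec.snd
      (Primrec.fst.comp (primrec_scan.comp (Primrec.snd.comp Primrec.snd)))).to₂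
  have hf : Primrec (ruleFinal (T := T) (N := N)) :=
    Primrec.list_map Primrec.id (Primrec.pair (.pair Primrec.snd (Primrec.const 0))
      (Primrec.fst.comp Primrec.snd)).to₂
  exact .pair (primrec_ruleEdges.comp Primrec.fst) (.pair (hi.comp Primrec.fst)
    (.pair (hf.comp Primrec.fst) Primrec.snd))

end Scan

namespace Recognizer

variable {T N σ : Type*} [Primcodable T] [Primcodable N] [Primcodable σ]

theorem primrec_states : Primrec (states : Recognizer T N σ → List (DState N σ)) :=
  primrec_product.comp
    (primrec_sublists'.comp (Primrec.list_map Primrec.fst (Primrec.snd.comp Primrec.snd).to₂))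
    (Primrec.list_cons.comp (Primrec.const none)
      (Primrec.list_map
        (primrec_sublists'.comp (Primrec.list_map
          (Primrec.fst.comp (Primrec.snd.comp Primrec.snd)) (Primrec.snd.comp Primrec.snd).to₂))
        (Primrec.option_some.comp Primrec.snd).to₂))

theorem primrec_terminals : Primrec (terminals : Recognizer T N σ → List T) := by
  have h : Primrec fun v : T ⊕ N => v.getLeft? :=
    (Primrec.sumCasesOn Primrec.id (Primrec.option_some.comp Primrec.snd).to₂
      (Primrec.const none).to₂).of_eq fun v => by cases v <;> rfl
  exact Primrec.listFilterMap Primrec.fst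
    (h.comp (Primrec.snd.comp (Primrec.fst.comp Primrec.snd))).to₂

variable [DecidableEq N] [DecidableEq σ]

theorem primrecRel_final :
    PrimrecRel fun (q : DState N σ) (X : Recognizer T N σ) => X.Final q := by
  have hl : Primrec fun x : DState N σ × Recognizer T N σ =>
      x.1.2.getD (select x.2.2.2.1 x.2.2.1) :=
    Primrec.option_getD.comp (Primrec.snd.comp Primrec.fst) (primrec_select.comp
      (Primrec.fst.comp (Primrec.snd.comp (Primrec.snd.comp Primrec.snd)))
      (Primrec.fst.comp (Primrec.snd.comp Primrec.snd)))
  exact primrecRel_mem.exists_mem_list.comp hl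
    (Primrec.snd.comp (Primrec.snd.comp (Primrec.snd.comp Primrec.snd)))

variable {α : Type*} [Primcodable α] {X : α → Recognizer T N σ} {D : α → List σ}
  {p : α → Option (List N)} {a : α → T} {q r : α → DState N σ}

theorem primrec_idxOf_states (hX : Primrec X) (hq : Primrec q) :
    Primrec fun x => (X x).states.idxOf (q x) :=
  -- The two index functions use a priori different Boolean equality tests, which both decide
  -- equality.
  (Primrec.list_idxOf.comp hq (primrec_states.comp hX)).of_eq fun x => by
    congr 1
    ext a b
    rw [Bool.eq_iff_iff]
    simp

variable [DecidableEq T]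

theorem primrec_read (hX : Primrec X) (hD : Primrec D) (hp : Primrec p) :
    Primrec fun x => (X x).read (D x) (p x) := by
  refine (Primrec.option_casesOn hp hD
    (g := fun x Cs => select (X x).1 (D x ×ˢ Cs.map Sum.inr)) ?_).of_eq fun x => ?_
  · exact primrec_select.comp (Primrec.fst.comp (hX.comp Primrec.fst))
      (primrec_product.comp (hD.comp Primrec.fst)
        (Primrec.list_map Primrec.snd (Primrec.sumInr.comp Primrec.snd).to₂))
  · cases h : p x <;> rfl

theorem primrec_advance (hX : Primrec X) (hD : Primrec D) (hp : Primrec p) (ha : Primrec a) :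
    Primrec fun x => (X x).advance (D x) (p x) (a x) :=
  primrec_select.comp (Primrec.fst.comp hX) (primrec_product.comp (primrec_read hX hD hp)
    (Primrec.list_cons.comp (Primrec.sumInl.comp ha) (Primrec.const [])))

theorem primrec_shift (hX : Primrec X) (hq : Primrec q) (ha : Primrec a) :
    Primrec fun x => (X x).shift (q x) (a x) :=
  .pair (primrec_advance hX (Primrec.fst.comp hq) (Primrec.snd.comp hq) ha) (Primrec.const none)

theorem primrec_push (hX : Primrec X) (hq : Primrec q) (ha : Primrec a) :
    Primrec fun x => (X x).push (q x) (a x) :=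
  .pair (primrec_advance hX (Primrec.fst.comp (Primrec.snd.comp hX)) (Primrec.snd.comp hq) ha)
    (Primrec.const none)

theorem primrec_pop (hX : Primrec X) (hq : Primrec q) (hr : Primrec r) :
    Primrec fun x => (X x).pop (q x) (r x) :=
  .pair (Primrec.fst.comp hr) (Primrec.option_some.comp (primrec_select.comp
    (Primrec.fst.comp (Primrec.snd.comp (Primrec.snd.comp hX)))
    (primrec_read hX (Primrec.fst.comp hq) (Primrec.snd.comp hq))))

theorem primrec_code : Primrec (code : Recognizer T N σ → OPACode T) := by
  have hS := primrec_states (T := T) (N := N) (σ := σ)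
  have X₁ : Primrec fun x : Recognizer T N σ × DState N σ => x.1 := Primrec.fst
  have q₁ : Primrec fun x : Recognizer T N σ × DState N σ => x.2 := Primrec.snd
  have X₂ : Primrec fun x : (Recognizer T N σ × DState N σ) × T => x.1.1 :=
    X₁.comp Primrec.fst
  have q₂ : Primrec fun x : (Recognizer T N σ × DState N σ) × T => x.1.2 :=
    q₁.comp Primrec.fst
  have X₃ : Primrec fun x : (Recognizer T N σ × DState N σ) × DState N σ => x.1.1 :=
    X₁.comp Primrec.fst
  have q₃ : Primrec fun x : (Recognizer T N σ × DState N σ) × DState N σ => x.1.2 :=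
    q₁.comp Primrec.fst
  refine .pair (Primrec.list_length.comp hS) (.pair ?_ (.pair ?_ (.pair ?_ (.pair ?_ ?_))))
  · exact Primrec.list_cons.comp (primrec_idxOf_states Primrec.id (Primrec.const _))
      (Primrec.const [])
  · exact Primrec.list_map (primrecRel_final.listFilter.comp hS Primrec.id)
      (primrec_idxOf_states X₁ q₁).to₂
  · exact Primrec.list_flatMap hS (Primrec.list_map (primrec_terminals.comp X₁)
      (Primrec.pair (primrec_idxOf_states X₂ q₂) (.pair Primrec.snd
        (primrec_idxOf_states X₂ (primrec_shift X₂ q₂ Primrec.snd)))).to₂).to₂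
  · exact Primrec.list_flatMap hS (Primrec.list_map (primrec_terminals.comp X₁)
      (Primrec.pair (primrec_idxOf_states X₂ q₂) (.pair Primrec.snd
        (primrec_idxOf_states X₂ (primrec_push X₂ q₂ Primrec.snd)))).to₂).to₂
  · exact Primrec.list_flatMap hS (Primrec.list_map (hS.comp X₁)
      (Primrec.pair (primrec_idxOf_states X₃ q₃) (.pair (primrec_idxOf_states X₃ Primrec.snd)
        (primrec_idxOf_states X₃ (primrec_pop X₃ q₃ Primrec.snd)))).to₂).to₂

end Recognizer

end OPL

theorem theorem1 {T N : Type*} [Primcodable T] [Primcodable N] :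
    ∃ f : OPL.GrammarCode T N → OPL.OPACode T, Computable f ∧
      ∀ M : OPL.OPM T, M.ConflictFree →
        ∀ G : OPL.Grammar T N, G.IsCOPG → G.opm ≤ M →
          (OPL.OPACode.toOPA (f G.write) M).language = G.language ∧
          (G.BackwardDeterministic → (OPL.OPACode.toOPA (f G.write) M).Deterministic) := by
  -- Classical equality tests do no harm: the functions are shown to be primitive recursive for
  -- every choice of these tests.
  classical
  refine ⟨fun g => (OPL.GrammarCode.recognizer g).code,
    (OPL.Recognizer.primrec_code.comp OPL.primrec_recognizer).to_comp, ?_⟩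
  intro M _ G hG hM
  refine ⟨?_, fun _ => OPL.Recognizer.deterministic_code _ M⟩
  rw [OPL.Recognizer.language_code]
  exact OPL.Recognizer.language_toOPA G.recognizes hG.isCOG hM
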